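/- **Fuk–Nagaev inequality for $\tau$-mixing processes.** For a random vector $X$ in $\mathbb{R}^l$ and a $\sigma$-algebra $\mathcal{M}$ put $\tau(\mathcal{M},X)=\big\|\sup_{f}|\mathbb{E}(f(X)\mid\mathcal{M})-\mathbb{E}f(X)|\big\|_1$, where the supremum is over all $f:\mathbb{R}^l\to\mathbb{R}$ with $|f(x)-f(y)|\le|x-y|_1=\sum_i|x_i-y_i|$ and the conditional expectations are computed with a regular conditional distribution of $X$ given $\mathcal{M}$. The $\tau$-mixing coefficients of a real process $(X_t)_{t\in\mathbb{Z}}$ with past $\sigma$-algebras $\mathcal{M}_t=\sigma(X_t,X_{t-1},\dots)$ are $$\tau_k=\sup_{j\ge1}\frac1j\ \sup_{t+k\le t_1<\dots<t_j}\tau\big(\mathcal{M}_t,(X_{t_1},\dots,X_{t_j})\big),$$ where the inner supremum is over all $t\in\mathbb{Z}$ and all such integers $t_1,\dots,t_j$. Let $q>2$, $a>0$, $c>0$ and $M\in\mathbb{R}$. Then there exist constants $c_1,c_2>0$, depending only on $(q,a,c,M)$, such that the following holds for all $p,T\in\mathbb{N}$ and every process $(\xi_t)_{t\in\mathbb{Z}}$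 in $\mathbb{R}^p$ (not necessarily stationary), on any probability space, that is centered (each $\xi_{t,j}$ is integrable with $\mathbb{E}\xi_{t,j}=0$) and satisfies (i) $(\mathbb{E}|\xi_{t,j}|^q)^{1/q}\le M$ for all $1\le j\le p$ and $1\le t\le T$; (ii) for every $1\le j\le p$, the $\tau$-mixing coefficients $\tau^{(j)}_k$ of the real process $(\xi_{t,j})_{t\in\mathbb{Z}}$ satisfy $\tau^{(j)}_k\le c\,k^{-a}$ for all $k\ge1$. For every $u>0$, $$\Pr\left(\Big|\sum_{t=1}^T\xi_t\Big|_\infty>u\right)\le c_1\,p\,T\,u^{-\kappa}+4p\exp\left(-\frac{c_2u^2}{B_T^2}\right),$$ where $|\cdot|_\infty$ is the maximum norm on $\mathbb{R}^p$, $$\kappa=\frac{(a+1)q-1}{a+q-1},\qquad B_T^2=\max_{1\le j\le p}\sum_{t=1}^T\sum_{k=1}^T|\mathrm{Cov}(\xi_{t,j},\xi_{k,j})|,$$ and the exponential is read as $0$ when $B_T^2=0$. -/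

import Mathlib

open MeasureTheory ProbabilityTheory

open scoped ENNReal

/-- The real functions on `ℝ^l` that are `1`-Lipschitz for the `ℓ₁` norm. -/
def LipOne (l : ℕ) : Set ((Fin l → ℝ) → ℝ) :=
  {f | ∀ x y : Fin l → ℝ, |f x - f y| ≤ ∑ i, |x i - y i|}

/-- A regular conditional distribution of the random vector `X` given the sub-`σ`-algebra `m`:
the conditional distribution of `X` given the identity map `(Ω, mΩ) → (Ω, m)`. -/
noncomputable def condLaw {Ω : Type*} (m : MeasurableSpace Ω) [mΩ : MeasurableSpace Ω]
    (μ : Measure Ω) [IsFiniteMeasure μ] {l : ℕ} (X : Ω → Fin l → ℝ) : @Kernel Ω (Fin l → ℝ) m inferInstance :=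
  @condDistrib Ω Ω (Fin l → ℝ) inferInstance inferInstance inferInstance mΩ m X id μ inferInstance

/-- The dependence coefficient
`τ(m, X) = ‖ sup_{f ∈ Lip₁} |E(f(X) | m) - E(f(X))| ‖₁`
of a random vector `X` in `ℝ^l` and a `σ`-algebra `m`, where the conditional expectations are
computed simultaneously for all `f` with a regular conditional distribution of `X` given `m`. -/
noncomputable def tauCoeff {Ω : Type*} (m : MeasurableSpace Ω) [MeasurableSpace Ω]
    (μ : Measure Ω) [IsFiniteMeasure μ] {l : ℕ} (X : Ω → Fin l → ℝ) : ℝ≥0∞ :=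
  ∫⁻ ω, ⨆ f ∈ LipOne l, ENNReal.ofReal |∫ x, f x ∂(condLaw m μ X ω) - ∫ ω', f (X ω') ∂μ| ∂μ

/-- The `σ`-algebra `σ(X_t, X_{t-1}, …)` generated by the past of a real process. -/
@[reducible] def pastSigma {Ω : Type*} (X : ℤ → Ω → ℝ) (t : ℤ) : MeasurableSpace Ω :=
  ⨆ (s : ℤ) (_ : s ≤ t), MeasurableSpace.comap (X s) inferInstance

/-- The `τ`-mixing coefficient of a real process:
`τ_k = sup_{j ≥ 1} (1/j) sup_{t + k ≤ t₁ < ⋯ < t_j} τ(σ(X_t, X_{t-1}, …), (X_{t₁}, …, X_{t_j}))`,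
with values in `[0, ∞]`. -/
noncomputable def tauMixing {Ω : Type*} [MeasurableSpace Ω] (μ : Measure Ω) [IsFiniteMeasure μ]
    (X : ℤ → Ω → ℝ) (k : ℕ) : ℝ≥0∞ :=
  ⨆ (j : ℕ) (_ : 1 ≤ j), (j : ℝ≥0∞)⁻¹ *
    ⨆ (t : ℤ) (s : Fin j → ℤ) (_ : StrictMono s) (_ : ∀ i, t + k ≤ s i),
      tauCoeff (pastSigma X t) μ (fun ω i => X (s i) ω)

/-- `B_T² = max_j ∑_{t=1}^T ∑_{k=1}^T |Cov(ξ_{t,j}, ξ_{k,j})|`. -/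
noncomputable def sumCovSq {Ω : Type*} [MeasurableSpace Ω] (μ : Measure Ω) {p : ℕ}
    (ξ : ℤ → Ω → Fin p → ℝ) (T : ℕ) : ℝ :=
  ⨆ j : Fin p, ∑ t ∈ Finset.Icc (1 : ℤ) T, ∑ k ∈ Finset.Icc (1 : ℤ) T,
    |cov[fun ω => ξ t ω j, fun ω => ξ k ω j; μ]|

/-- The Gaussian tail `exp(-x / v)` for `x > 0`, `v ≥ 0`, read as its limit `0` when `v = 0`. -/
noncomputable def expNegDiv (x v : ℝ) : ℝ :=
  if v = 0 then 0 else Real.exp (-(x / v))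

/-! For one coordinate, `1, …, T` is cut into consecutive blocks of length `J`, and even-numbered
and odd-numbered blocks are treated apart, so that the blocks kept are separated by gaps of length
`J`. A Lipschitz function of the sum of block sums then changes little when the blocks are replaced
one at a time by independent copies: each replacement costs the Lipschitz constant times the
`τ`-coefficient of the block, hence `x⁻¹ T τ_J` in total at scale `x`
(`ofReal_decouple_le_tauCoeff`, `integral_sum_le_of_decouple`). A ramp function transfers this to
tail probabilities.

The independent block sums obey the classical Fuk–Nagaev inequality (`fukNagaev_indep`), proved by
truncation and Chernoff's bound. Their variances add up to at most the full sum of absolute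
covariances, and their `q`-th moments to at most `J ^ (q - 1) * T * K`, where `K` bounds the
individual `q`-th moments.

The polynomial errors are thus of order `T J ^ (q - 1) u ^ (-q)` and `T u⁻¹ J ^ (-a)`. Taking `J` of
order `u ^ ((q - 1) / (a + q - 1))` makes both of order `T u ^ (-κ)`. A union bound over coordinates
finishes the proof. -/

/-! ### Exponential moments of truncated variables and the independent case -/

lemma exp_le_one_add_add_sq_mul_exp {w q : ℝ} (hq : 0 ≤ q) (hw : w ≤ q) :
    Real.exp w ≤ 1 + w + w ^ 2 * Real.exp q := by
  have hq1 : 1 ≤ Real.exp q := Real.one_le_exp hq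
  have hwq : Real.exp w ≤ Real.exp q := Real.exp_le_exp.2 hw
  rcases le_or_gt w (-1) with h | h
  · have : Real.exp w ≤ 1 := Real.exp_le_one_iff.2 (by linarith)
    nlinarith [sq_nonneg w]
  · have hmain : Real.exp w * (1 - w) ≤ 1 := by
      have h1 : 1 - w ≤ Real.exp (-w) := by linarith [Real.add_one_le_exp (-w)]
      calc Real.exp w * (1 - w) ≤ Real.exp w * Real.exp (-w) := by gcongr
        _ = 1 := by rw [← Real.exp_add]; simp
    have h2 : Real.exp w * (1 - w ^ 2) ≤ 1 + w := by nlinarith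
    nlinarith [mul_le_mul_of_nonneg_left hwq (sq_nonneg w)]

/-- For `l * x ≤ q` the quadratic bound on the exponential suffices. Beyond `q / l` the map `x ↦ exp
(l * x) * x ^ (-q)` is increasing, so the `q`-th moment term alone dominates up to the truncation
level `y`; past `y` the factor `(x / y) ^ q` is at least `1`. -/
lemma exp_mul_min_le {q l y : ℝ} (hq : 0 < q) (hl : 0 < l) (hy : 0 < y) (x : ℝ) :
    Real.exp (l * min x y) ≤
      1 + l * x + Real.exp q * l ^ 2 * x ^ 2 + Real.exp (l * y) * y ^ (-q) * |x| ^ q := by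
  have hlast : 0 ≤ Real.exp (l * y) * y ^ (-q) * |x| ^ q := by positivity
  rcases le_or_gt (l * x) q with h | h
  · rcases le_or_gt x y with hxy | hxy
    · rw [min_eq_left hxy]
      have := exp_le_one_add_add_sq_mul_exp hq.le h
      nlinarith
    · rw [min_eq_right hxy.le]
      have := exp_le_one_add_add_sq_mul_exp hq.le h
      have : Real.exp (l * y) ≤ Real.exp (l * x) := by gcongr
      nlinarith
  · have hx : 0 < x := by
      by_contra hx
      nlinarith
    have key : Real.exp (l * min x y) ≤ Real.exp (l * y) * y ^ (-q) * |x| ^ q := by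
      rw [abs_of_pos hx, Real.rpow_def_of_pos hx, Real.rpow_def_of_pos hy, ← Real.exp_add,
        ← Real.exp_add]
      apply Real.exp_le_exp.2
      rcases le_or_gt x y with hxy | hxy
      · rw [min_eq_left hxy]
        have h1 : Real.log y - Real.log x ≤ y / x - 1 := by
          rw [← Real.log_div hy.ne' hx.ne']
          exact Real.log_le_sub_one_of_pos (by positivity)
        have h2 : q * (y / x - 1) ≤ l * (y - x) := by
          have : y / x - 1 = (y - x) / x := by field_simp
          rw [this, mul_div_assoc', div_le_iff₀ hx]
          nlinarith
        nlinarith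
      · rw [min_eq_right hxy.le]
        have := Real.log_le_log hy hxy.le
        nlinarith
    have : 0 ≤ Real.exp q * l ^ 2 * x ^ 2 := by positivity
    nlinarith

lemma mgf_min_le {Ω : Type*} [MeasurableSpace Ω] {μ : Measure Ω} [IsProbabilityMeasure μ]
    {X : Ω → ℝ} {q l y : ℝ} (hq : 2 < q) (hl : 0 < l) (hy : 0 < y)
    (hX : MemLp X (ENNReal.ofReal q) μ) (h0 : ∫ ω, X ω ∂μ = 0) :
    mgf (fun ω => min (X ω) y) μ l ≤
      Real.exp (Real.exp q * l ^ 2 * Var[X; μ] +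
        Real.exp (l * y) * y ^ (-q) * ∫ ω, |X ω| ^ q ∂μ) := by
  have hX2 : MemLp X 2 μ := hX.mono_exponent (by
    rw [show (2 : ℝ≥0∞) = ENNReal.ofReal 2 by simp]
    exact ENNReal.ofReal_le_ofReal hq.le)
  have hX1 : Integrable X μ := hX2.integrable (by norm_num)
  have hXq : Integrable (fun ω => |X ω| ^ q) μ := by
    have := hX.integrable_norm_rpow (by simp; linarith) (by simp)
    simpa [ENNReal.toReal_ofReal (by linarith : (0 : ℝ) ≤ q)] using this
  have hvar : Var[X; μ] = ∫ ω, X ω ^ 2 ∂μ := by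
    rw [variance_eq_integral hX1.aemeasurable, h0]; simp
  have hi1 : Integrable (fun ω => Real.exp q * l ^ 2 * X ω ^ 2) μ :=
    hX2.integrable_sq.const_mul _
  have hi2 : Integrable (fun ω => Real.exp (l * y) * y ^ (-q) * |X ω| ^ q) μ := hXq.const_mul _
  have hi3 : Integrable (fun ω => 1 + l * X ω) μ := (integrable_const _).add (hX1.const_mul _)
  calc mgf (fun ω => min (X ω) y) μ l
      ≤ ∫ ω, (1 + l * X ω + Real.exp q * l ^ 2 * X ω ^ 2 +
          Real.exp (l * y) * y ^ (-q) * |X ω| ^ q) ∂μ := by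
        apply integral_mono_of_nonneg
        · exact Filter.Eventually.of_forall fun ω => (Real.exp_pos _).le
        · exact (hi3.add hi1).add hi2
        · exact Filter.Eventually.of_forall fun ω => exp_mul_min_le (by linarith) hl hy _
    _ = (Real.exp q * l ^ 2 * Var[X; μ] +
        Real.exp (l * y) * y ^ (-q) * ∫ ω, |X ω| ^ q ∂μ) + 1 := by
        have e1 := integral_add (hi3.add hi1) hi2
        simp only [Pi.add_apply] at e1
        rw [e1, integral_add hi3 hi1, integral_add (integrable_const _) (hX1.const_mul _), integral_const_mul,
          integral_const_mul, integral_const_mul, h0, hvar]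
        simp
        ring
    _ ≤ _ := Real.add_one_le_exp _

lemma measureReal_lt_le_integral_rpow {Ω : Type*} [MeasurableSpace Ω] {μ : Measure Ω}
    [IsFiniteMeasure μ] {X : Ω → ℝ} {q y : ℝ} (hq : 0 < q) (hy : 0 < y)
    (hX : Integrable (fun ω => |X ω| ^ q) μ) :
    μ.real {ω | y < X ω} ≤ (∫ ω, |X ω| ^ q ∂μ) / y ^ q := by
  rw [le_div_iff₀ (by positivity), mul_comm]
  refine le_trans ?_ (mul_meas_ge_le_integral_of_nonneg
    (Filter.Eventually.of_forall fun ω => by positivity) hX (y ^ q))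
  gcongr
  · finiteness
  · rename_i ω
    intro hω
    exact Real.rpow_le_rpow hy.le (hω.le.trans (le_abs_self _)) hq.le

/-- The one-sided Fuk–Nagaev inequality for independent centered random variables. -/
theorem fukNagaev_indep {Ω ι : Type*} [MeasurableSpace Ω] {μ : Measure Ω} [IsProbabilityMeasure μ]
    {X : ι → Ω → ℝ} (s : Finset ι) {q A B x : ℝ} (hq : 2 < q) (hA : 0 < A) (hB : 0 < B)
    (hx : 0 < x) (hm : ∀ i, Measurable (X i)) (hind : iIndepFun X μ)
    (hX : ∀ i ∈ s, MemLp (X i) (ENNReal.ofReal q) μ) (h0 : ∀ i ∈ s, ∫ ω, X i ω ∂μ = 0)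
    (hAs : ∑ i ∈ s, ∫ ω, |X i ω| ^ q ∂μ ≤ A) (hBs : ∑ i ∈ s, Var[X i; μ] ≤ B) :
    μ.real {ω | x < ∑ i ∈ s, X i ω} ≤
      (1 + Real.exp 1) * 2 ^ q * A / x ^ q +
        Real.exp 1 * Real.exp (-(x ^ 2 / (4 * Real.exp q * B))) := by
  have hq0 : 0 < q := by linarith
  set y := x / 2 with hy_def
  have hy : 0 < y := by positivity
  have hxq : x ^ q = 2 ^ q * y ^ q := by
    rw [← Real.mul_rpow (by norm_num) hy.le]; congr 1; rw [hy_def]; ring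
  have hyq : 0 < y ^ q := by positivity
  have hK : (1 + Real.exp 1) * 2 ^ q * A / x ^ q = A / y ^ q + Real.exp 1 * (A / y ^ q) := by
    rw [hxq]; field_simp
  rw [hK]
  have he : 0 < Real.exp 1 * Real.exp (-(x ^ 2 / (4 * Real.exp q * B))) := by positivity
  -- If `y ^ q ≤ A`, the polynomial term already exceeds `1`; otherwise the logarithm in `l₂` below
  -- is positive.
  rcases le_or_gt (y ^ q) A with hAy | hAy
  · have h1 : 1 ≤ A / y ^ q := by rwa [one_le_div hyq]
    have : 0 ≤ Real.exp 1 * (A / y ^ q) := by positivity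
    linarith [measureReal_le_one (μ := μ) (s := {ω | x < ∑ i ∈ s, X i ω})]
  have hXq : ∀ i ∈ s, Integrable (fun ω => |X i ω| ^ q) μ := fun i hi => by
    have := (hX i hi).integrable_norm_rpow (by simp; linarith) (by simp)
    simpa [ENNReal.toReal_ofReal hq0.le] using this
  have hsplit : μ.real {ω | x < ∑ i ∈ s, X i ω} ≤
      ∑ i ∈ s, μ.real {ω | y < X i ω} + μ.real {ω | x ≤ ∑ i ∈ s, min (X i ω) y} := by
    have hsub : {ω | x < ∑ i ∈ s, X i ω} ⊆
        (⋃ i ∈ s, {ω | y < X i ω}) ∪ {ω | x ≤ ∑ i ∈ s, min (X i ω) y} := by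
      intro ω hω
      by_cases h : ∃ i ∈ s, y < X i ω
      · left
        simpa using h
      · right
        push Not at h
        simp only [Set.mem_ofPred_eq] at hω ⊢
        rw [Finset.sum_congr rfl fun i hi => min_eq_left (h i hi)]
        exact hω.le
    refine (measureReal_mono hsub).trans ((measureReal_union_le _ _).trans ?_)
    gcongr
    exact measureReal_biUnion_finset_le _ _
  have htail : ∑ i ∈ s, μ.real {ω | y < X i ω} ≤ A / y ^ q :=
    calc ∑ i ∈ s, μ.real {ω | y < X i ω}
        ≤ ∑ i ∈ s, (∫ ω, |X i ω| ^ q ∂μ) / y ^ q :=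
          Finset.sum_le_sum fun i hi => measureReal_lt_le_integral_rpow hq0 hy (hXq i hi)
      _ ≤ A / y ^ q := by
          rw [← Finset.sum_div]
          gcongr
  have hcher : ∀ l, 0 < l → μ.real {ω | x ≤ ∑ i ∈ s, min (X i ω) y} ≤
      Real.exp (-l * x + (Real.exp q * l ^ 2 * B + Real.exp (l * y) * y ^ (-q) * A)) := by
    intro l hl
    have hmin : ∀ i, Measurable (fun ω => min (X i ω) y) := fun i => (hm i).min measurable_const
    have hindm : iIndepFun (fun i ω => min (X i ω) y) μ :=
      hind.comp (fun _ z => min z y) fun _ => measurable_id.min measurable_const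
    have hint : Integrable (fun ω => Real.exp (l * (∑ i ∈ s, fun ω => min (X i ω) y) ω)) μ := by
      refine Integrable.of_bound (C := Real.exp (l * ∑ i ∈ s, y)) ?_ ?_
      · have : Measurable (∑ i ∈ s, fun ω => min (X i ω) y) := by
          convert Finset.measurable_sum s fun i _ => hmin i using 1
          ext
          simp
        exact (Real.measurable_exp.comp (this.const_mul l)).aestronglyMeasurable
      · refine Filter.Eventually.of_forall fun ω => ?_
        rw [Real.norm_eq_abs, Real.abs_exp, Finset.sum_apply]
        gcongr
        exact min_le_right _ _
    have := measure_ge_le_exp_mul_mgf x hl.le hint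
    rw [hindm.mgf_sum hmin] at this
    simp only [Finset.sum_apply] at this
    refine this.trans ?_
    rw [Real.exp_add]
    gcongr
    calc ∏ i ∈ s, mgf (fun ω => min (X i ω) y) μ l
        ≤ ∏ i ∈ s, Real.exp (Real.exp q * l ^ 2 * Var[X i; μ] +
            Real.exp (l * y) * y ^ (-q) * ∫ ω, |X i ω| ^ q ∂μ) :=
          Finset.prod_le_prod (fun i _ => mgf_nonneg)
            fun i hi => mgf_min_le hq hl hy (hX i hi) (h0 i hi)
      _ ≤ _ := by
          rw [← Real.exp_sum, Finset.sum_add_distrib, ← Finset.mul_sum, ← Finset.mul_sum]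
          gcongr
  -- For `l ≤ l₁` the variance term is at most `l * y`, and for `l ≤ l₂` the moment term is at most
  -- `1`. As `x = 2 * y`, the Chernoff exponent is then at most `1 - l * y`. The smaller of the two
  -- values is used: `l₁` produces the Gaussian term, `l₂` the term `A / y ^ q`.
  set l₁ := x / (2 * Real.exp q * B) with hl₁
  set l₂ := Real.log (y ^ q / A) / y with hl₂
  have hl₁0 : 0 < l₁ := by positivity
  have hl₂0 : 0 < l₂ := div_pos (Real.log_pos (by rwa [one_lt_div hA])) hy
  have hmain : ∀ l, 0 < l → l ≤ l₁ → l ≤ l₂ → μ.real {ω | x ≤ ∑ i ∈ s, min (X i ω) y} ≤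
      Real.exp 1 * Real.exp (-(l * y)) := by
    intro l hl hle₁ hle₂
    refine (hcher l hl).trans ?_
    rw [← Real.exp_add]
    apply Real.exp_le_exp.2
    have e1 : Real.exp (l * y) * y ^ (-q) * A ≤ 1 := by
      have : Real.exp (l * y) ≤ y ^ q / A := by
        rw [← Real.exp_log (show 0 < y ^ q / A by positivity)]
        apply Real.exp_le_exp.2
        rwa [← le_div_iff₀ hy]
      calc Real.exp (l * y) * y ^ (-q) * A ≤ y ^ q / A * y ^ (-q) * A := by gcongr
        _ = 1 := by rw [Real.rpow_neg hy.le]; field_simp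
    have e2 : Real.exp q * l ^ 2 * B ≤ l * y := by
      rw [hl₁, le_div_iff₀ (by positivity)] at hle₁
      have hxy : x = 2 * y := by rw [hy_def]; ring
      nlinarith
    have hxy : x = 2 * y := by rw [hy_def]; ring
    rw [hxy]
    linarith
  have hfin : μ.real {ω | x ≤ ∑ i ∈ s, min (X i ω) y} ≤
      Real.exp 1 * (A / y ^ q) + Real.exp 1 * Real.exp (-(x ^ 2 / (4 * Real.exp q * B))) := by
    rcases le_total l₁ l₂ with h | h
    · refine (hmain l₁ hl₁0 le_rfl h).trans ?_
      have : l₁ * y = x ^ 2 / (4 * Real.exp q * B) := by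
        rw [hl₁, hy_def]; field_simp; ring
      rw [this]
      have : 0 ≤ Real.exp 1 * (A / y ^ q) := by positivity
      linarith
    · refine (hmain l₂ hl₂0 h le_rfl).trans ?_
      have : Real.exp (-(l₂ * y)) = A / y ^ q := by
        rw [hl₂, div_mul_cancel₀ _ hy.ne', Real.exp_neg, Real.exp_log (by positivity), inv_div]
      rw [this]
      linarith
  linarith

/-! ### Decoupling blocks through the `τ`-coefficient -/

lemma integral_add_lipschitz {Ω : Type*} [MeasurableSpace Ω] {μ : Measure Ω} [IsProbabilityMeasure μ]
    {V : Ω → ℝ} (hV : Measurable V) {h : ℝ → ℝ} {L : ℝ}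
    (hL : ∀ x y, |h x - h y| ≤ L * |x - y|) (hc : Continuous h) (hb : ∀ x, |h x| ≤ 1) (x y : ℝ) :
    |∫ ω, h (x + V ω) ∂μ - ∫ ω, h (y + V ω) ∂μ| ≤ L * |x - y| := by
  have hi : ∀ z, Integrable (fun ω => h (z + V ω)) μ := fun z =>
    Integrable.of_bound (by fun_prop) 1 (Filter.Eventually.of_forall fun ω => hb _)
  rw [← integral_sub (hi x) (hi y)]
  have := norm_integral_le_of_norm_le_const (μ := μ) (f := fun ω => h (x + V ω) - h (y + V ω))
    (C := L * |x - y|) (Filter.Eventually.of_forall fun ω => by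
      simpa using hL (x + V ω) (y + V ω))
  simpa using this

lemma continuous_of_abs_sub_le {h : ℝ → ℝ} {L : ℝ} (hL0 : 0 ≤ L)
    (hL : ∀ x y, |h x - h y| ≤ L * |x - y|) : Continuous h :=
  (LipschitzWith.of_dist_le_mul (K := ⟨L, hL0⟩) hL).continuous

/-- Since `S` is `m`-measurable, it can be frozen when conditioning on `m`: the inner integral is a
version of the conditional expectation, which gives both integrability and equality of means. -/
lemma integral_add_sum_eq_condLaw {Ω : Type*} {m mΩ : MeasurableSpace Ω} (hm : m ≤ mΩ)
    {μ : Measure Ω} [IsProbabilityMeasure μ] {l : ℕ} {X : Ω → Fin l → ℝ} (hX : Measurable X)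
    {S : Ω → ℝ} (hS : Measurable[m] S) {h : ℝ → ℝ} (hc : Continuous h) (hb : ∀ x, |h x| ≤ 1) :
    Integrable (fun ω => ∫ x, h (S ω + ∑ i, x i) ∂(condLaw m μ X ω)) μ ∧
    ∫ ω, h (S ω + ∑ i, X ω i) ∂μ = ∫ ω, ∫ x, h (S ω + ∑ i, x i) ∂(condLaw m μ X ω) ∂μ := by
  have hid : @Measurable Ω Ω mΩ m id := measurable_id'' hm
  have hf : @StronglyMeasurable (Ω × (Fin l → ℝ)) ℝ _ (@Prod.instMeasurableSpace _ _ m _)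
      (fun z => h (S z.1 + ∑ i, z.2 i)) := by
    apply Measurable.stronglyMeasurable
    apply hc.measurable.comp
    apply Measurable.add
    · exact hS.comp (@measurable_fst Ω _ m _)
    · exact Finset.measurable_sum _ fun i _ =>
        (measurable_pi_apply i).comp (@measurable_snd Ω _ m _)
  have hint : Integrable (fun ω => h (S ω + ∑ i, X ω i)) μ := by
    have hS' : Measurable S := hS.mono hm le_rfl
    exact Integrable.of_bound (by fun_prop) 1 (Filter.Eventually.of_forall fun ω => hb _)
  have key := @condExp_prod_ae_eq_integral_condDistrib Ω Ω (Fin l → ℝ) ℝ _ _ _ _ mΩ μ _ id X m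
    (fun z => h (S z.1 + ∑ i, z.2 i)) _ _ hid hX.aemeasurable hf hint
  rw [MeasurableSpace.comap_id] at key
  refine ⟨integrable_condExp.congr key, ?_⟩
  rw [← integral_condExp hm]
  exact integral_congr_ae key

/-- A Lipschitz function of a past variable plus a block can be decoupled at the price of the
dependence coefficient of the block. -/
lemma ofReal_decouple_le_tauCoeff {Ω : Type*} {m mΩ : MeasurableSpace Ω} (hm : m ≤ mΩ)
    {μ : Measure Ω} [IsProbabilityMeasure μ] {l : ℕ} {X : Ω → Fin l → ℝ} (hX : Measurable X)
    {S : Ω → ℝ} (hS : Measurable[m] S) {h : ℝ → ℝ} {L : ℝ} (hL0 : 0 < L)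
    (hL : ∀ x y, |h x - h y| ≤ L * |x - y|) (hb : ∀ x, |h x| ≤ 1) :
    ENNReal.ofReal (∫ ω, h (S ω + ∑ i, X ω i) ∂μ - ∫ ω, ∫ ω', h (S ω + ∑ i, X ω' i) ∂μ ∂μ) ≤
      ENNReal.ofReal L * tauCoeff m μ X := by
  have hc : Continuous h := continuous_of_abs_sub_le hL0.le hL
  have hS' : Measurable S := hS.mono hm le_rfl
  have hV : Measurable (fun ω => ∑ i, X ω i) := by fun_prop
  obtain ⟨hGi, hG⟩ := integral_add_sum_eq_condLaw (μ := μ) hm hX hS hc hb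
  set G : Ω → ℝ := fun ω => ∫ x, h (S ω + ∑ i, x i) ∂(condLaw m μ X ω) with hGdef
  have hφ : Continuous (fun s => ∫ ω', h (s + ∑ i, X ω' i) ∂μ) :=
    continuous_of_abs_sub_le hL0.le fun x y => integral_add_lipschitz (μ := μ) hV hL hc hb x y
  set H : Ω → ℝ := fun ω => ∫ ω', h (S ω + ∑ i, X ω' i) ∂μ with hHdef
  have hHi : Integrable H μ := by
    refine Integrable.of_bound (hφ.measurable.comp hS').aestronglyMeasurable 1
      (Filter.Eventually.of_forall fun ω => ?_)
    have := norm_integral_le_of_norm_le_const (μ := μ) (f := fun ω' => h (S ω + ∑ i, X ω' i))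
      (C := 1) (Filter.Eventually.of_forall fun ω' => hb _)
    simpa using this
  rw [hG, ← integral_sub hGi hHi]
  calc ENNReal.ofReal (∫ ω, (G ω - H ω) ∂μ)
      ≤ ENNReal.ofReal (∫ ω, |G ω - H ω| ∂μ) := by
        apply ENNReal.ofReal_le_ofReal
        exact integral_mono (hGi.sub hHi) (hGi.sub hHi).abs fun ω => le_abs_self _
    _ = ∫⁻ ω, ENNReal.ofReal |G ω - H ω| ∂μ :=
        ofReal_integral_eq_lintegral_ofReal (hGi.sub hHi).abs
          (Filter.Eventually.of_forall fun ω => abs_nonneg _)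
    _ ≤ ∫⁻ ω, ENNReal.ofReal L * ⨆ f ∈ LipOne l,
          ENNReal.ofReal |∫ x, f x ∂(condLaw m μ X ω) - ∫ ω', f (X ω') ∂μ| ∂μ := by
        apply lintegral_mono
        intro ω
        -- The test function depends on `ω` through `S ω`, which is why the supremum in `tauCoeff`
        -- must stand inside the integral. Summing coordinates is `1`-Lipschitz for the `ℓ₁` norm,
        -- so dividing by `L` is enough.
        have hmem : (fun x : Fin l → ℝ => L⁻¹ * h (S ω + ∑ i, x i)) ∈ LipOne l := by
          intro x y
          rw [← mul_sub, abs_mul, abs_of_pos (inv_pos.2 hL0), inv_mul_le_iff₀ hL0]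
          refine (hL _ _).trans ?_
          gcongr
          rw [add_sub_add_left_eq_sub, ← Finset.sum_sub_distrib]
          exact Finset.abs_sum_le_sum_abs _ _
        have hle := le_iSup₂ (f := fun f (_ : f ∈ LipOne l) =>
          ENNReal.ofReal |∫ x, f x ∂(condLaw m μ X ω) - ∫ ω', f (X ω') ∂μ|) _ hmem
        refine le_trans (le_of_eq ?_) (mul_le_mul_right hle (ENNReal.ofReal L))
        rw [integral_const_mul, integral_const_mul, ← mul_sub, abs_mul,
          abs_of_pos (inv_pos.2 hL0), ← ENNReal.ofReal_mul hL0.le, mul_inv_cancel_left₀ hL0.ne']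
    _ = ENNReal.ofReal L * tauCoeff m μ X := by
        rw [lintegral_const_mul' _ _ ENNReal.ofReal_ne_top]
        rfl

lemma tauCoeff_orderEmbOfFin_le {Ω : Type*} [MeasurableSpace Ω] {μ : Measure Ω}
    [IsFiniteMeasure μ] (X : ℤ → Ω → ℝ) (s : Finset ℤ) (hs : s.Nonempty) {t : ℤ} {k : ℕ}
    (hts : ∀ i ∈ s, t + k ≤ i) :
    tauCoeff (pastSigma X t) μ (fun ω i => X (s.orderEmbOfFin rfl i) ω) ≤
      s.card * tauMixing μ X k := by
  have hcard : 1 ≤ s.card := hs.card_pos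
  have h1 : (s.card : ℝ≥0∞)⁻¹ *
      tauCoeff (pastSigma X t) μ (fun ω i => X (s.orderEmbOfFin rfl i) ω) ≤ tauMixing μ X k := by
    refine le_trans ?_ (le_iSup₂ (f := fun (j : ℕ) (_ : 1 ≤ j) => (j : ℝ≥0∞)⁻¹ *
      ⨆ (t : ℤ) (s : Fin j → ℤ) (_ : StrictMono s) (_ : ∀ i, t + k ≤ s i),
        tauCoeff (pastSigma X t) μ (fun ω i => X (s i) ω)) s.card hcard)
    gcongr
    refine le_iSup_of_le t (le_iSup_of_le (s.orderEmbOfFin rfl) ?_)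
    exact le_iSup_of_le (s.orderEmbOfFin rfl).strictMono (le_iSup_of_le
      (fun i => hts _ (s.orderEmbOfFin_mem rfl i)) le_rfl)
  rwa [ENNReal.inv_mul_le_iff (by simpa using hs.ne_empty) (by simp)] at h1

lemma measurable_pastSigma {Ω : Type*} (X : ℤ → Ω → ℝ) {t i : ℤ} (hi : i ≤ t) :
    Measurable[pastSigma X t] (X i) := by
  refine (comap_measurable (X i)).mono ?_ le_rfl
  exact le_iSup₂_of_le i hi le_rfl

lemma integral_decouple_le {Ω : Type*} [MeasurableSpace Ω]
    {μ : Measure Ω} [IsProbabilityMeasure μ] {X : ℤ → Ω → ℝ} (hX : ∀ i, Measurable (X i))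
    (s : Finset ℤ) {t : ℤ} {k : ℕ} (hts : ∀ i ∈ s, t + k ≤ i) {τ : ℝ} (hτ0 : 0 ≤ τ)
    (hτ : tauMixing μ X k ≤ ENNReal.ofReal τ)
    {S : Ω → ℝ} (hS : Measurable[pastSigma X t] S) {h : ℝ → ℝ} {L : ℝ} (hL0 : 0 < L)
    (hL : ∀ x y, |h x - h y| ≤ L * |x - y|) (hb : ∀ x, |h x| ≤ 1) :
    ∫ ω, h (S ω + ∑ i ∈ s, X i ω) ∂μ ≤
      ∫ ω, ∫ ω', h (S ω + ∑ i ∈ s, X i ω') ∂μ ∂μ + L * (s.card * τ) := by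
  -- `tauMixing` only involves `j ≥ 1`, so the empty block is treated apart; it costs nothing.
  rcases s.eq_empty_or_nonempty with rfl | hs
  · simp
  have hm : pastSigma X t ≤ ‹MeasurableSpace Ω› :=
    iSup₂_le fun i _ => (hX i).comap_le
  have hsum : ∀ ω, ∑ i ∈ s, X i ω = ∑ i, X (s.orderEmbOfFin rfl i) ω := by
    intro ω
    rw [← Finset.sum_coe_sort, ← Equiv.sum_comp (s.orderIsoOfFin rfl).toEquiv]
    rfl
  have h1 := ofReal_decouple_le_tauCoeff hm (μ := μ)
    (X := fun ω i => X (s.orderEmbOfFin rfl i) ω)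
    (measurable_pi_lambda _ fun i => hX _) hS hL0 hL hb
  have h2 := h1.trans (mul_le_mul_right ((tauCoeff_orderEmbOfFin_le X s hs hts).trans
    (mul_le_mul_right hτ _)) _)
  rw [← ENNReal.ofReal_natCast, ← ENNReal.ofReal_mul (by positivity),
    ← ENNReal.ofReal_mul hL0.le, ENNReal.ofReal_le_ofReal_iff (by positivity)] at h2
  simp only [hsum]
  linarith

/-- Replacement of the blocks of a dependent sequence by independent copies inside a Lipschitz
function of the sum. -/
lemma integral_sum_le_of_decouple {Ω Ω' : Type*} [MeasurableSpace Ω] [MeasurableSpace Ω']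
    {μ : Measure Ω} [IsProbabilityMeasure μ] {μ' : Measure Ω'} [IsProbabilityMeasure μ']
    {V : ℕ → Ω → ℝ} (hV : ∀ i, Measurable (V i)) {W : ℕ → Ω' → ℝ} (hW : ∀ i, Measurable (W i))
    (hind : iIndepFun W μ') (hlaw : ∀ i, μ'.map (W i) = μ.map (V i)) {ε : ℕ → ℝ} {L : ℝ}
    (hL0 : 0 < L)
    (hstep : ∀ n, ∀ h : ℝ → ℝ, (∀ x y, |h x - h y| ≤ L * |x - y|) → (∀ x, |h x| ≤ 1) →
      ∫ ω, h (∑ i ∈ Finset.range n, V i ω + V n ω) ∂μ ≤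
        ∫ ω, ∫ ω', h (∑ i ∈ Finset.range n, V i ω + V n ω') ∂μ ∂μ + L * ε n) (n : ℕ) :
    ∀ h : ℝ → ℝ, (∀ x y, |h x - h y| ≤ L * |x - y|) → (∀ x, |h x| ≤ 1) →
      ∫ ω, h (∑ i ∈ Finset.range n, V i ω) ∂μ ≤
        ∫ ω, h (∑ i ∈ Finset.range n, W i ω) ∂μ' + L * ∑ i ∈ Finset.range n, ε i := by
  induction n with
  | zero => simp
  | succ n ih =>
    intro h hL hb
    have hc : Continuous h := continuous_of_abs_sub_le hL0.le hL
    have h1 := hstep n h hL hb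
    -- Averaging `h` over an independent copy of the last block keeps both its Lipschitz constant
    -- and its bound, so the induction hypothesis applies to the average.
    have h2 := ih (fun s => ∫ ω', h (s + V n ω') ∂μ)
      (fun x y => integral_add_lipschitz (hV n) hL hc hb x y) (fun x => by
        have := norm_integral_le_of_norm_le_const (μ := μ) (f := fun ω' => h (x + V n ω'))
          (C := 1) (Filter.Eventually.of_forall fun ω' => hb _)
        simpa using this)
    have h3 : ∫ ω, ∫ ω', h (∑ i ∈ Finset.range n, W i ω + V n ω') ∂μ ∂μ' =
        ∫ ω, h (∑ i ∈ Finset.range (n + 1), W i ω) ∂μ' := by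
      have hmS : Measurable (fun ω => ∑ i ∈ Finset.range n, W i ω) :=
        Finset.measurable_sum _ fun i _ => hW i
      have hin : IndepFun (fun ω => ∑ i ∈ Finset.range n, W i ω) (W n) μ' := by
        have := hind.indepFun_finsetSum_of_notMem hW (s := Finset.range n) (i := n) (by simp)
        convert this using 1
        ext
        simp
      have hprod := (indepFun_iff_map_prod_eq_prod_map_map hmS.aemeasurable (hW n).aemeasurable).1 hin
      have hh : StronglyMeasurable (fun z : ℝ × ℝ => h (z.1 + z.2)) :=
        (hc.comp (continuous_fst.add continuous_snd)).stronglyMeasurable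
      have : IsProbabilityMeasure (μ'.map (fun ω => ∑ i ∈ Finset.range n, W i ω)) :=
        Measure.isProbabilityMeasure_map hmS.aemeasurable
      have : IsProbabilityMeasure (μ'.map (W n)) :=
        Measure.isProbabilityMeasure_map (hW n).aemeasurable
      simp_rw [Finset.sum_range_succ]
      have e1 : ∫ ω, h (∑ i ∈ Finset.range n, W i ω + W n ω) ∂μ' =
          ∫ z, h (z.1 + z.2) ∂(μ'.map fun ω => (∑ i ∈ Finset.range n, W i ω, W n ω)) := by
        rw [integral_map (hmS.prodMk (hW n)).aemeasurable hh.aestronglyMeasurable]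
      rw [e1, hprod, integral_prod _ (Integrable.of_bound hh.aestronglyMeasurable 1
        (Filter.Eventually.of_forall fun _ => hb _)),
        integral_map hmS.aemeasurable hh.integral_prod_right.aestronglyMeasurable]
      congr 1
      ext ω
      rw [hlaw n, integral_map (hV n).aemeasurable (by fun_prop)]
    simp only [Finset.sum_range_succ] at h3 ⊢
    rw [mul_add]
    linarith

/-- The two-sided Fuk–Nagaev inequality for independent centered random variables. -/
theorem fukNagaev_indep_abs {Ω ι : Type*} [MeasurableSpace Ω] {μ : Measure Ω}
    [IsProbabilityMeasure μ]
    {X : ι → Ω → ℝ} (s : Finset ι) {q A B x : ℝ} (hq : 2 < q) (hA : 0 < A) (hB : 0 < B)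
    (hx : 0 < x) (hm : ∀ i, Measurable (X i)) (hind : iIndepFun X μ)
    (hX : ∀ i ∈ s, MemLp (X i) (ENNReal.ofReal q) μ) (h0 : ∀ i ∈ s, ∫ ω, X i ω ∂μ = 0)
    (hAs : ∑ i ∈ s, ∫ ω, |X i ω| ^ q ∂μ ≤ A) (hBs : ∑ i ∈ s, Var[X i; μ] ≤ B) :
    μ.real {ω | x < |∑ i ∈ s, X i ω|} ≤
      2 * ((1 + Real.exp 1) * 2 ^ q * A / x ^ q +
        Real.exp 1 * Real.exp (-(x ^ 2 / (4 * Real.exp q * B)))) := by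
  have h1 := fukNagaev_indep s hq hA hB hx hm hind hX h0 hAs hBs
  have h2 := fukNagaev_indep (X := fun i => -X i) s hq hA hB hx (fun i => (hm i).neg)
    (hind.comp (fun _ z => -z) fun _ => measurable_neg) (fun i hi => (hX i hi).neg)
    (fun i hi => by simp [integral_neg, h0 i hi]) (by simpa using hAs)
    (by simpa [variance_neg] using hBs)
  have hsub : {ω | x < |∑ i ∈ s, X i ω|} ⊆
      {ω | x < ∑ i ∈ s, X i ω} ∪ {ω | x < ∑ i ∈ s, (-X i) ω} := by
    intro ω hω
    have : x < |∑ i ∈ s, X i ω| := hω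
    rcases lt_abs.1 this with h | h
    · exact Or.inl h
    · right
      simpa using h
  have := (measureReal_mono (μ := μ) hsub).trans (measureReal_union_le _ _)
  linarith

/-! ### Lipschitz smoothing of the tail event -/

/-- A Lipschitz function between the indicators of `|s| ≥ 2x` and `|s| > x`. -/
noncomputable def tailRamp (x s : ℝ) : ℝ := min 1 (max 0 (x⁻¹ * |s| - 1))

lemma tailRamp_nonneg (x s : ℝ) : 0 ≤ tailRamp x s :=
  le_min zero_le_one (le_max_left _ _)

lemma tailRamp_le_one (x s : ℝ) : tailRamp x s ≤ 1 := min_le_left _ _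

lemma abs_tailRamp_sub_le {x : ℝ} (hx : 0 < x) (s t : ℝ) :
    |tailRamp x s - tailRamp x t| ≤ x⁻¹ * |s - t| := by
  have h1 : |tailRamp x s - tailRamp x t| ≤ |(x⁻¹ * |s| - 1) - (x⁻¹ * |t| - 1)| := by
    unfold tailRamp
    refine (abs_min_sub_min_le_max _ _ _ _).trans ?_
    rw [sub_self, abs_zero]
    refine max_le (abs_nonneg (_ : ℝ)) ((abs_max_sub_max_le_max _ _ _ _).trans ?_)
    simp
  refine h1.trans ?_
  rw [sub_sub_sub_cancel_right, ← mul_sub, abs_mul, abs_of_pos (inv_pos.2 hx)]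
  exact mul_le_mul_of_nonneg_left (abs_abs_sub_abs_le s t) (inv_pos.2 hx).le

lemma tailRamp_eq_one {x s : ℝ} (hx : 0 < x) (hs : 2 * x < |s|) : tailRamp x s = 1 := by
  have : 1 ≤ x⁻¹ * |s| - 1 := by
    rw [le_sub_iff_add_le, inv_mul_eq_div, le_div_iff₀ hx]
    linarith
  exact min_eq_left (this.trans (le_max_right _ _))

lemma tailRamp_eq_zero {x s : ℝ} (hx : 0 < x) (hs : |s| ≤ x) : tailRamp x s = 0 := by
  have : x⁻¹ * |s| - 1 ≤ 0 := by
    rw [sub_nonpos, inv_mul_eq_div, div_le_one hx]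
    exact hs
  rw [tailRamp, max_eq_left this]
  simp

lemma continuous_tailRamp (x : ℝ) : Continuous (tailRamp x) := by
  unfold tailRamp
  fun_prop

lemma measureReal_lt_abs_le_integral_tailRamp {Ω : Type*} [MeasurableSpace Ω] {μ : Measure Ω}
    [IsProbabilityMeasure μ] {Y : Ω → ℝ} (hY : Measurable Y) {x : ℝ} (hx : 0 < x) :
    μ.real {ω | 2 * x < |Y ω|} ≤ ∫ ω, tailRamp x (Y ω) ∂μ := by
  have hms : MeasurableSet {ω | 2 * x < |Y ω|} := measurableSet_lt measurable_const hY.abs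
  rw [← integral_indicator_one hms]
  apply integral_mono
  · exact (integrable_const (1 : ℝ)).indicator hms
  · refine Integrable.of_bound ((continuous_tailRamp x).measurable.comp hY).aestronglyMeasurable 1
      (Filter.Eventually.of_forall fun ω => ?_)
    rw [Real.norm_eq_abs, abs_of_nonneg (tailRamp_nonneg _ _)]
    exact tailRamp_le_one _ _
  · intro ω
    by_cases h : ω ∈ {ω | 2 * x < |Y ω|}
    · rw [Set.indicator_of_mem h]
      exact (tailRamp_eq_one hx h).ge
    · rw [Set.indicator_of_notMem h]
      exact tailRamp_nonneg _ _

lemma integral_tailRamp_le {Ω : Type*} [MeasurableSpace Ω] {μ : Measure Ω}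
    [IsProbabilityMeasure μ] {Y : Ω → ℝ} (hY : Measurable Y) {x : ℝ} (hx : 0 < x) :
    ∫ ω, tailRamp x (Y ω) ∂μ ≤ μ.real {ω | x < |Y ω|} := by
  have hms : MeasurableSet {ω | x < |Y ω|} := measurableSet_lt measurable_const hY.abs
  rw [← integral_indicator_one hms]
  apply integral_mono
  · refine Integrable.of_bound ((continuous_tailRamp x).measurable.comp hY).aestronglyMeasurable 1
      (Filter.Eventually.of_forall fun ω => ?_)
    rw [Real.norm_eq_abs, abs_of_nonneg (tailRamp_nonneg _ _)]
    exact tailRamp_le_one _ _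
  · exact (integrable_const (1 : ℝ)).indicator hms
  · intro ω
    by_cases h : ω ∈ {ω | x < |Y ω|}
    · rw [Set.indicator_of_mem h]
      exact tailRamp_le_one _ _
    · rw [Set.indicator_of_notMem h]
      exact (tailRamp_eq_zero hx (not_lt.1 h)).le

/-! ### Moments and variances of blocks; tails of separated blocks -/

lemma integrable_abs_rpow {Ω : Type*} [MeasurableSpace Ω] {μ : Measure Ω} {X : Ω → ℝ} {q : ℝ}
    (hq : 0 < q) (hX : MemLp X (ENNReal.ofReal q) μ) : Integrable (fun ω => |X ω| ^ q) μ := by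
  have := hX.integrable_norm_rpow (by simpa using hq) (by simp)
  simpa [ENNReal.toReal_ofReal hq.le] using this

lemma integral_abs_sum_rpow_le {Ω ι : Type*} [MeasurableSpace Ω] {μ : Measure Ω}
    {X : ι → Ω → ℝ} (s : Finset ι) {q K : ℝ} {J : ℕ} (hq : 1 ≤ q) (hJ : s.card ≤ J)
    (hX : ∀ i ∈ s, MemLp (X i) (ENNReal.ofReal q) μ)
    (hK : ∀ i ∈ s, ∫ ω, |X i ω| ^ q ∂μ ≤ K) :
    ∫ ω, |∑ i ∈ s, X i ω| ^ q ∂μ ≤ (J : ℝ) ^ (q - 1) * (s.card * K) := by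
  have hi : ∀ i ∈ s, Integrable (fun ω => |X i ω| ^ q) μ := fun i his =>
    integrable_abs_rpow (by linarith) (hX i his)
  calc ∫ ω, |∑ i ∈ s, X i ω| ^ q ∂μ
      ≤ ∫ ω, (J : ℝ) ^ (q - 1) * ∑ i ∈ s, |X i ω| ^ q ∂μ := by
        apply integral_mono_of_nonneg
        · exact Filter.Eventually.of_forall fun ω => by positivity
        · exact (integrable_finsetSum _ hi).const_mul _
        · refine Filter.Eventually.of_forall fun ω => ?_
          calc |∑ i ∈ s, X i ω| ^ q ≤ (∑ i ∈ s, |X i ω|) ^ q := by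
                gcongr
                exact Finset.abs_sum_le_sum_abs _ _
            _ ≤ (s.card : ℝ) ^ (q - 1) * ∑ i ∈ s, |X i ω| ^ q :=
                Real.rpow_sum_le_const_mul_sum_rpow s _ hq
            _ ≤ (J : ℝ) ^ (q - 1) * ∑ i ∈ s, |X i ω| ^ q := by gcongr
    _ = (J : ℝ) ^ (q - 1) * ∑ i ∈ s, ∫ ω, |X i ω| ^ q ∂μ := by
        rw [integral_const_mul, integral_finsetSum _ hi]
    _ ≤ _ := by
        gcongr
        rw [← nsmul_eq_mul]
        exact Finset.sum_le_card_nsmul _ _ _ hK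

/-- Expanding the block variances leaves only covariances of pairs in a common block. With absolute
values, adding the remaining pairs can only increase the sum. -/
lemma sum_variance_fiber_le {Ω : Type*} [MeasurableSpace Ω] {μ : Measure Ω} [IsFiniteMeasure μ]
    {ι : Type*} {X : ι → Ω → ℝ} (A : Finset ι) (g : ι → ℕ) {N : ℕ} (hN : ∀ t ∈ A, g t < N)
    (hX : ∀ i ∈ A, MemLp (X i) 2 μ) :
    ∑ n ∈ Finset.range N, Var[fun ω => ∑ i ∈ A with g i = n, X i ω; μ] ≤
      ∑ s ∈ A, ∑ t ∈ A, |cov[X s, X t; μ]| := by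
  rw [← Finset.sum_fiberwise_of_maps_to (s := A) (t := Finset.range N) (g := g)
    (by simpa using hN)]
  apply Finset.sum_le_sum
  intro n _
  rw [variance_fun_sum' fun i hi => hX i (Finset.mem_filter.1 hi).1]
  apply Finset.sum_le_sum
  intro s _
  calc ∑ t ∈ A with g t = n, cov[X s, X t; μ]
      ≤ ∑ t ∈ A with g t = n, |cov[X s, X t; μ]| :=
        Finset.sum_le_sum fun t _ => le_abs_self _
    _ ≤ ∑ t ∈ A, |cov[X s, X t; μ]| :=
        Finset.sum_le_sum_of_subset_of_nonneg (Finset.filter_subset _ _)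
          fun _ _ _ => abs_nonneg _

/-- Tail bound for a sum over blocks of at most `J` times which are separated by gaps `J`. -/
theorem measureReal_block_sum_le {Ω : Type*} [MeasurableSpace Ω] {μ : Measure Ω}
    [IsProbabilityMeasure μ] {X : ℤ → Ω → ℝ} (hX : ∀ i, Measurable (X i)) (A : Finset ℤ)
    (g : ℤ → ℕ) {N J T : ℕ} {q K B τ x : ℝ} (hq : 2 < q) (hK : 0 < K) (hB : 0 < B) (hT : 0 < T)
    (hJ : 0 < J) (hτ0 : 0 ≤ τ) (hx : 0 < x)
    (hsep : ∀ s ∈ A, ∀ t ∈ A, g s < g t → s + J ≤ t)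
    (hcard : ∀ n, (A.filter (fun t => g t = n)).card ≤ J) (hN : ∀ t ∈ A, g t < N)
    (hAT : A.card ≤ T) (hLq : ∀ t ∈ A, MemLp (X t) (ENNReal.ofReal q) μ)
    (h0 : ∀ t ∈ A, ∫ ω, X t ω ∂μ = 0) (hXK : ∀ t ∈ A, ∫ ω, |X t ω| ^ q ∂μ ≤ K)
    (hXB : ∑ s ∈ A, ∑ t ∈ A, |cov[X s, X t; μ]| ≤ B)
    (hτ : tauMixing μ X J ≤ ENNReal.ofReal τ) :
    μ.real {ω | 2 * x < |∑ t ∈ A, X t ω|} ≤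
      2 * ((1 + Real.exp 1) * 2 ^ q * ((J : ℝ) ^ (q - 1) * (T * K)) / x ^ q +
        Real.exp 1 * Real.exp (-(x ^ 2 / (4 * Real.exp q * B)))) + x⁻¹ * (T * τ) := by
  set b : ℕ → Finset ℤ := fun n => A.filter (fun t => g t = n) with hb
  have hbA : ∀ n, ∀ t ∈ b n, t ∈ A := fun n t ht => (Finset.mem_filter.1 ht).1
  set V : ℕ → Ω → ℝ := fun n ω => ∑ t ∈ b n, X t ω with hV
  have hVm : ∀ n, Measurable (V n) := fun n => Finset.measurable_sum _ fun i _ => hX i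
  have hVsum : ∀ ω, ∑ n ∈ Finset.range N, V n ω = ∑ t ∈ A, X t ω := fun ω =>
    Finset.sum_fiberwise_of_maps_to (by simpa using hN) _
  have hbcard : ∑ n ∈ Finset.range N, (b n).card = A.card :=
    (Finset.card_eq_sum_card_fiberwise (by simpa [Set.MapsTo] using hN)).symm
  have hbT : ∑ n ∈ Finset.range N, ((b n).card : ℝ) ≤ T := by
    rw [← Nat.cast_sum, hbcard]
    exact_mod_cast hAT
  have hL2 : ∀ t ∈ A, MemLp (X t) 2 μ := fun t ht => (hLq t ht).mono_exponent (by
    rw [show (2 : ℝ≥0∞) = ENNReal.ofReal 2 by simp]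
    exact ENNReal.ofReal_le_ofReal hq.le)
  have hV0 : ∀ n, ∫ ω, V n ω ∂μ = 0 := fun n => by
    rw [integral_finsetSum _ fun t ht => (hL2 t (hbA n t ht)).integrable (by norm_num)]
    exact Finset.sum_eq_zero fun t ht => h0 t (hbA n t ht)
  have hVq : ∀ n, MemLp (V n) (ENNReal.ofReal q) μ := fun n =>
    memLp_finsetSum _ fun t ht => hLq t (hbA n t ht)
  have hstep : ∀ n, ∀ h : ℝ → ℝ, (∀ y z, |h y - h z| ≤ x⁻¹ * |y - z|) → (∀ y, |h y| ≤ 1) →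
      ∫ ω, h (∑ i ∈ Finset.range n, V i ω + V n ω) ∂μ ≤
        ∫ ω, ∫ ω', h (∑ i ∈ Finset.range n, V i ω + V n ω') ∂μ ∂μ +
          x⁻¹ * ((b n).card * τ) := by
    intro n h hL hb1
    -- A time `t` at which all earlier blocks are past while block `n` starts at least `J` later:
    -- the minimum of the block minus `J`, or any upper bound of `A` if the block is empty.
    obtain ⟨t, ht1, ht2⟩ : ∃ t : ℤ, (∀ s ∈ A, g s < n → s ≤ t) ∧ ∀ i ∈ b n, t + J ≤ i := by
      rcases (b n).eq_empty_or_nonempty with he | hne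
      · obtain ⟨t, ht⟩ := A.bddAbove
        exact ⟨t, fun s hs _ => ht hs, by simp [he]⟩
      · have hmin := Finset.mem_filter.1 ((b n).min'_mem hne)
        refine ⟨(b n).min' hne - J, fun s hs hsn => ?_, fun i hi => ?_⟩
        · have := hsep s hs _ hmin.1 (by rw [hmin.2]; exact hsn)
          linarith
        · have := (b n).min'_le i hi
          linarith
    refine integral_decouple_le hX (b n) ht2 hτ0 hτ ?_ (inv_pos.2 hx) hL hb1
    refine Finset.measurable_sum _ fun i hi => Finset.measurable_sum _ fun s hs => ?_
    have hs' := Finset.mem_filter.1 hs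
    exact measurable_pastSigma X (ht1 s hs'.1 (by rw [hs'.2]; simpa using hi))
  have hprob : ∀ n, IsProbabilityMeasure (μ.map (V n)) := fun n =>
    Measure.isProbabilityMeasure_map (hVm n).aemeasurable
  -- The coordinates of this product space are independent copies of the block sums.
  set P := Measure.infinitePi fun n => μ.map (V n) with hP
  set W : ℕ → (ℕ → ℝ) → ℝ := fun n w => w n with hW
  have hWm : ∀ n, Measurable (W n) := fun n => measurable_pi_apply n
  have hlaw : ∀ n, P.map (W n) = μ.map (V n) := fun n => Measure.infinitePi_map_eval _ n
  have hid : ∀ n, IdentDistrib (W n) (V n) P μ := fun n =>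
    ⟨(hWm n).aemeasurable, (hVm n).aemeasurable, hlaw n⟩
  have hind : iIndepFun W P := iIndepFun_infinitePi (X := fun _ z => z) fun _ => measurable_id
  -- The ramp has Lipschitz constant `x⁻¹`; passing through it lowers the threshold from `2 * x` to
  -- `x`.
  have hswap := integral_sum_le_of_decouple hVm hWm hind hlaw (inv_pos.2 hx) hstep N (tailRamp x)
    (abs_tailRamp_sub_le hx)
    (fun y => by rw [abs_of_nonneg (tailRamp_nonneg _ _)]; exact tailRamp_le_one _ _)
  have hfn := fukNagaev_indep_abs (μ := P) (X := W) (Finset.range N) hq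
    (A := (J : ℝ) ^ (q - 1) * (T * K)) (B := B) (x := x) (by positivity) hB hx hWm hind
    (fun n _ => (hid n).memLp_iff.2 (hVq n)) (fun n _ => by rw [(hid n).integral_eq, hV0])
    (by
      have : ∀ n ∈ Finset.range N, ∫ w, |W n w| ^ q ∂P ≤ (J : ℝ) ^ (q - 1) * ((b n).card * K) := by
        intro n _
        have hm : Measurable fun z : ℝ => |z| ^ q := by fun_prop
        have := ((hid n).comp hm).integral_eq
        simp only [Function.comp_def] at this
        rw [this]
        exact integral_abs_sum_rpow_le (b n) (by linarith) (hcard n)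
          (fun t ht => hLq t (hbA n t ht)) fun t ht => hXK t (hbA n t ht)
      refine (Finset.sum_le_sum this).trans ?_
      rw [← Finset.mul_sum, ← Finset.sum_mul]
      gcongr)
    (by
      rw [Finset.sum_congr rfl fun n _ => (hid n).variance_eq]
      exact (sum_variance_fiber_le A g hN hL2).trans hXB)
  have h1 := measureReal_lt_abs_le_integral_tailRamp (μ := μ)
    (Y := fun ω => ∑ n ∈ Finset.range N, V n ω) (Finset.measurable_sum _ fun n _ => hVm n) hx
  have h2 := integral_tailRamp_le (μ := P)
    (Y := fun ω => ∑ n ∈ Finset.range N, W n ω) (Finset.measurable_sum _ fun n _ => hWm n) hx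
  have h3 : x⁻¹ * ∑ n ∈ Finset.range N, ((b n).card : ℝ) * τ ≤ x⁻¹ * (T * τ) := by
    rw [← Finset.sum_mul]
    gcongr
  simp only [hVsum] at h1 hswap
  linarith

/-! ### Even and odd blocks of an interval -/

/-- Times start at `1`, so `(t - 1) / J` is the block number counted from `0`. Distinct block
numbers of equal parity differ by at least `2`, so a full block of length `J` lies between. -/
lemma add_le_of_ediv_block_lt {J s t : ℤ} (hJ : 0 < J) (hs : 1 ≤ s)
    (hmod : (s - 1) / J % 2 = (t - 1) / J % 2)
    (hlt : ((s - 1) / J / 2).toNat < ((t - 1) / J / 2).toNat) : s + J ≤ t := by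
  have h1 : 0 ≤ (s - 1) / J := Int.ediv_nonneg (by linarith) hJ.le
  have h2 : (s - 1) / J + 2 ≤ (t - 1) / J := by omega
  have h3 := Int.lt_ediv_add_one_mul_self (s - 1) hJ
  have h4 := Int.ediv_mul_le (t - 1) hJ.ne'
  nlinarith

lemma card_ediv_block_le (A : Finset ℤ) {J : ℕ} (hJ : 0 < J) (r : ℤ) (hA : ∀ t ∈ A, 1 ≤ t)
    (hr : ∀ t ∈ A, (t - 1) / J % 2 = r) (n : ℕ) :
    (A.filter fun t => ((t - 1) / (J : ℤ) / 2).toNat = n).card ≤ J := by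
  have hJ' : (0 : ℤ) < J := by exact_mod_cast hJ
  have hsub : (A.filter fun t => ((t - 1) / (J : ℤ) / 2).toNat = n) ⊆
      Finset.Ico ((2 * n + r) * J + 1) ((2 * n + r) * J + 1 + J) := by
    intro t ht
    obtain ⟨htA, htn⟩ := Finset.mem_filter.1 ht
    have h1 : 0 ≤ (t - 1) / (J : ℤ) := Int.ediv_nonneg (by linarith [hA t htA]) hJ'.le
    have h2 := hr t htA
    have h3 : (t - 1) / (J : ℤ) = 2 * n + r := by omega
    have h4 := Int.lt_ediv_add_one_mul_self (t - 1) hJ'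
    have h5 := Int.ediv_mul_le (t - 1) hJ'.ne'
    rw [h3] at h4 h5
    rw [Finset.mem_Ico]
    constructor <;> linarith
  refine (Finset.card_le_card hsub).trans ?_
  simp

/-- If the total exceeds `4 * x` in absolute value, the even or the odd blocks contribute more than
`2 * x`. Each parity class has gaps of length `J`, which accounts for the doubled constants. -/
lemma measureReal_sum_le_of_block_length {Ω : Type*} [MeasurableSpace Ω] {μ : Measure Ω}
    [IsProbabilityMeasure μ] {X : ℤ → Ω → ℝ} (hX : ∀ i, Measurable (X i))
    {J T : ℕ} {q K B τ x : ℝ} (hq : 2 < q) (hK : 0 < K) (hB : 0 < B) (hT : 0 < T)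
    (hJ : 0 < J) (hτ0 : 0 ≤ τ) (hx : 0 < x)
    (hLq : ∀ t ∈ Finset.Icc (1 : ℤ) T, MemLp (X t) (ENNReal.ofReal q) μ)
    (h0 : ∀ t ∈ Finset.Icc (1 : ℤ) T, ∫ ω, X t ω ∂μ = 0)
    (hXK : ∀ t ∈ Finset.Icc (1 : ℤ) T, ∫ ω, |X t ω| ^ q ∂μ ≤ K)
    (hXB : ∑ s ∈ Finset.Icc (1 : ℤ) T, ∑ t ∈ Finset.Icc (1 : ℤ) T, |cov[X s, X t; μ]| ≤ B)
    (hτ : tauMixing μ X J ≤ ENNReal.ofReal τ) :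
    μ.real {ω | 4 * x < |∑ t ∈ Finset.Icc (1 : ℤ) T, X t ω|} ≤
      4 * ((1 + Real.exp 1) * 2 ^ q * ((J : ℝ) ^ (q - 1) * (T * K)) / x ^ q +
        Real.exp 1 * Real.exp (-(x ^ 2 / (4 * Real.exp q * B)))) + 2 * (x⁻¹ * (T * τ)) := by
  have hJ' : (0 : ℤ) < J := by exact_mod_cast hJ
  have hpart : ∀ A ⊆ Finset.Icc (1 : ℤ) T, ∀ r : ℤ, (∀ t ∈ A, (t - 1) / (J : ℤ) % 2 = r) →
      μ.real {ω | 2 * x < |∑ t ∈ A, X t ω|} ≤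
      2 * ((1 + Real.exp 1) * 2 ^ q * ((J : ℝ) ^ (q - 1) * (T * K)) / x ^ q +
        Real.exp 1 * Real.exp (-(x ^ 2 / (4 * Real.exp q * B)))) + x⁻¹ * (T * τ) := by
    intro A hA r hr
    have h1 : ∀ t ∈ A, 1 ≤ t := fun t ht => (Finset.mem_Icc.1 (hA ht)).1
    refine measureReal_block_sum_le hX A (fun t => ((t - 1) / (J : ℤ) / 2).toNat) (N := T)
      hq hK hB hT hJ hτ0 hx (fun s hs t ht hst => ?_) (card_ediv_block_le A hJ r h1 hr)
      (fun t ht => ?_) ?_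
      (fun t ht => hLq t (hA ht)) (fun t ht => h0 t (hA ht)) (fun t ht => hXK t (hA ht)) ?_ hτ
    · exact add_le_of_ediv_block_lt hJ' (h1 s hs) ((hr s hs).trans (hr t ht).symm) hst
    · have h2 := Finset.mem_Icc.1 (hA ht)
      have h3 : (t - 1) / (J : ℤ) ≤ t - 1 := Int.ediv_le_self _ (by linarith)
      omega
    · simpa using Finset.card_le_card hA
    · refine le_trans ?_ hXB
      refine (Finset.sum_le_sum fun s _ => Finset.sum_le_sum_of_subset_of_nonneg hA
        fun _ _ _ => abs_nonneg _).trans ?_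
      exact Finset.sum_le_sum_of_subset_of_nonneg hA
        fun _ _ _ => Finset.sum_nonneg fun _ _ => abs_nonneg _
  set A₀ := (Finset.Icc (1 : ℤ) T).filter fun t => (t - 1) / (J : ℤ) % 2 = 0
  set A₁ := (Finset.Icc (1 : ℤ) T).filter fun t => ¬ (t - 1) / (J : ℤ) % 2 = 0
  have e0 := hpart A₀ (Finset.filter_subset _ _) 0 fun t ht => (Finset.mem_filter.1 ht).2
  have e1 := hpart A₁ (Finset.filter_subset _ _) 1 fun t ht => by
    have := (Finset.mem_filter.1 ht).2
    omega
  have hsub : {ω | 4 * x < |∑ t ∈ Finset.Icc (1 : ℤ) T, X t ω|} ⊆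
      {ω | 2 * x < |∑ t ∈ A₀, X t ω|} ∪ {ω | 2 * x < |∑ t ∈ A₁, X t ω|} := by
    intro ω hω
    have h1 : 4 * x < |∑ t ∈ Finset.Icc (1 : ℤ) T, X t ω| := hω
    rw [← Finset.sum_filter_add_sum_filter_not _ fun t : ℤ => (t - 1) / (J : ℤ) % 2 = 0] at h1
    by_contra hne
    simp only [Set.mem_union, Set.mem_ofPred_eq, not_or, not_lt] at hne
    have := abs_add_le (∑ t ∈ A₀, X t ω) (∑ t ∈ A₁, X t ω)
    linarith [hne.1, hne.2]
  have := (measureReal_mono (μ := μ) hsub).trans (measureReal_union_le _ _)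
  linarith

/-! ### Block length, degenerate covariances and the scalar inequality -/

lemma integral_abs_rpow_le_of_eLpNorm_le {Ω : Type*} [MeasurableSpace Ω] {μ : Measure Ω}
    {X : Ω → ℝ} {q M : ℝ} (hq : 0 < q) (hX : MemLp X (ENNReal.ofReal q) μ) (hM0 : 0 ≤ M)
    (hM : eLpNorm X (ENNReal.ofReal q) μ ≤ ENNReal.ofReal M) : ∫ ω, |X ω| ^ q ∂μ ≤ M ^ q := by
  rw [hX.eLpNorm_eq_integral_rpow_norm (by simpa using hq) (by simp),
    ENNReal.toReal_ofReal hq.le, ENNReal.ofReal_le_ofReal_iff hM0] at hM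
  simp only [Real.norm_eq_abs] at hM
  have hnn : 0 ≤ ∫ ω, |X ω| ^ q ∂μ := integral_nonneg fun ω => by positivity
  have := Real.rpow_le_rpow (by positivity) hM hq.le
  rwa [← Real.rpow_mul hnn, inv_mul_cancel₀ hq.ne', Real.rpow_one] at this

/-- The choice of block length which balances the moment and the mixing terms. -/
lemma exists_block_length {q a u : ℝ} (hq : 2 < q) (ha : 0 < a) (hu : 1 ≤ u) :
    ∃ J : ℕ, 0 < J ∧
      (J : ℝ) ^ (q - 1) / u ^ q ≤ u ^ (-(((a + 1) * q - 1) / (a + q - 1))) ∧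
      u⁻¹ * (J : ℝ) ^ (-a) ≤ 2 ^ a * u ^ (-(((a + 1) * q - 1) / (a + q - 1))) := by
  have hu0 : 0 < u := by linarith
  have hd : 0 < a + q - 1 := by linarith
  -- With `J ≈ u ^ θ`, this `θ` solves `θ * (q - 1) - q = -1 - a * θ`, and the common value is the
  -- exponent `-κ`.
  set θ := (q - 1) / (a + q - 1) with hθ
  have hθ0 : 0 ≤ θ := div_nonneg (by linarith) hd.le
  have h1 : 1 ≤ u ^ θ := Real.one_le_rpow hu hθ0
  have hJ1 : 1 ≤ ⌊u ^ θ⌋₊ := Nat.one_le_floor_iff _ |>.2 h1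
  refine ⟨⌊u ^ θ⌋₊, hJ1, ?_, ?_⟩
  · have hle : (⌊u ^ θ⌋₊ : ℝ) ≤ u ^ θ := Nat.floor_le (by positivity)
    calc (⌊u ^ θ⌋₊ : ℝ) ^ (q - 1) / u ^ q ≤ (u ^ θ) ^ (q - 1) / u ^ q := by
          gcongr
          linarith
      _ = u ^ (-(((a + 1) * q - 1) / (a + q - 1))) := by
          rw [← Real.rpow_mul hu0.le, ← Real.rpow_sub hu0]
          congr 1
          rw [hθ]
          field_simp
          ring
  · have hge : u ^ θ / 2 ≤ (⌊u ^ θ⌋₊ : ℝ) := by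
      have h2 := Nat.lt_floor_add_one (u ^ θ)
      have h3 : (1 : ℝ) ≤ ⌊u ^ θ⌋₊ := by exact_mod_cast hJ1
      linarith
    calc u⁻¹ * (⌊u ^ θ⌋₊ : ℝ) ^ (-a) ≤ u⁻¹ * (u ^ θ / 2) ^ (-a) := by
          gcongr ?_ * ?_
          exact Real.rpow_le_rpow_of_nonpos (by positivity) hge (by linarith)
      _ = 2 ^ a * u ^ (-(((a + 1) * q - 1) / (a + q - 1))) := by
          rw [Real.div_rpow (by positivity) (by norm_num), ← Real.rpow_mul hu0.le,
            Real.rpow_neg (by norm_num : (0 : ℝ) ≤ 2), div_inv_eq_mul, ← Real.rpow_neg_one u,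
            ← mul_assoc, ← Real.rpow_add hu0, mul_comm]
          congr 2
          rw [hθ]
          field_simp
          ring

/-- This covers `B = 0`, where the exponential is read as `0`: the diagonal covariances vanish, so
the centered variables are almost surely zero. -/
lemma measureReal_lt_abs_sum_eq_zero {Ω ι : Type*} [MeasurableSpace Ω] {μ : Measure Ω}
    [IsProbabilityMeasure μ] {X : ι → Ω → ℝ} {s : Finset ι} {u : ℝ} (hu : 0 < u)
    (hX : ∀ t ∈ s, MemLp (X t) 2 μ) (h0 : ∀ t ∈ s, ∫ ω, X t ω ∂μ = 0)
    (hcov : ∑ i ∈ s, ∑ t ∈ s, |cov[X i, X t; μ]| ≤ 0) :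
    μ.real {ω | u < |∑ t ∈ s, X t ω|} = 0 := by
  have hvar : ∀ t ∈ s, Var[X t; μ] = 0 := by
    intro t ht
    rw [← covariance_self (hX t ht).aemeasurable]
    have h1 : |cov[X t, X t; μ]| ≤ ∑ i ∈ s, |cov[X t, X i; μ]| :=
      Finset.single_le_sum (f := fun i => |cov[X t, X i; μ]|) (fun _ _ => abs_nonneg _) ht
    have h2 : ∑ i ∈ s, |cov[X t, X i; μ]| ≤ ∑ t ∈ s, ∑ i ∈ s, |cov[X t, X i; μ]| :=
      Finset.single_le_sum (f := fun t => ∑ i ∈ s, |cov[X t, X i; μ]|)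
        (fun _ _ => Finset.sum_nonneg fun _ _ => abs_nonneg _) ht
    exact abs_nonpos_iff.1 (by linarith)
  have hae : ∀ᵐ ω ∂μ, ∀ t ∈ s, X t ω = 0 := by
    rw [Filter.eventually_all_finset]
    intro t ht
    filter_upwards [ae_eq_integral_of_variance_eq_zero (hX t ht) (hvar t ht)] with ω hω
    rw [hω, h0 t ht]
  have hnull : μ {ω | u < |∑ t ∈ s, X t ω|} = 0 := by
    refine measure_mono_null (fun ω hω => ?_) (ae_iff.1 hae)
    intro hall
    have h1 : u < |∑ t ∈ s, X t ω| := hω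
    rw [Finset.sum_eq_zero hall, abs_zero] at h1
    linarith
  simp [measureReal_def, hnull]

/-- Half of the exponential rate is given up to absorb the factor `e`. If `exp (-z) ≥ 1 / 4` the
bound is trivial; otherwise `e * exp (-z) ≤ 1`, since `e < 4`. -/
lemma le_add_four_mul_exp {P R z : ℝ} (hP : P ≤ 1) (hR : 0 ≤ R)
    (h : P ≤ R + 4 * (Real.exp 1 * Real.exp (-(2 * z)))) : P ≤ R + 4 * Real.exp (-z) := by
  have hz := Real.exp_pos (-z)
  rw [show -(2 * z) = -z + -z by ring, Real.exp_add] at h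
  rcases le_or_gt (1 / 4) (Real.exp (-z)) with h1 | h1
  · linarith
  · have : Real.exp 1 * (Real.exp (-z) * Real.exp (-z)) ≤ Real.exp (-z) := by
      have h2 := Real.exp_one_lt_d9
      have h3 : Real.exp 1 * Real.exp (-z) ≤ 1 := by nlinarith
      nlinarith
    linarith

/-- The Fuk–Nagaev inequality for a real `τ`-mixing process. -/
theorem fukNagaev_tauMixing (q a c M : ℝ) (hq : 2 < q) (ha : 0 < a) (hc : 0 < c) :
    ∃ c₁ c₂ : ℝ, 0 < c₁ ∧ 0 < c₂ ∧
      ∀ (Ω : Type*) [MeasurableSpace Ω] (μ : Measure Ω) [IsProbabilityMeasure μ]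
        (T : ℕ) (X : ℤ → Ω → ℝ) (B : ℝ), (∀ t, Measurable (X t)) → 0 ≤ B →
        (∀ t, ∫ ω, X t ω ∂μ = 0) →
        (∀ t ∈ Finset.Icc (1 : ℤ) T,
          eLpNorm (X t) (ENNReal.ofReal q) μ ≤ ENNReal.ofReal M) →
        (∀ k : ℕ, 1 ≤ k → tauMixing μ X k ≤ ENNReal.ofReal (c * (k : ℝ) ^ (-a))) →
        ∑ s ∈ Finset.Icc (1 : ℤ) T, ∑ t ∈ Finset.Icc (1 : ℤ) T, |cov[X s, X t; μ]| ≤ B →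
        ∀ u : ℝ, 0 < u →
          μ.real {ω | u < |∑ t ∈ Finset.Icc (1 : ℤ) T, X t ω|} ≤
            c₁ * T * u ^ (-(((a + 1) * q - 1) / (a + q - 1))) +
              4 * expNegDiv (c₂ * u ^ 2) B := by
  -- The maximum with `1` keeps `K` positive for every real `M`.
  set K : ℝ := (max M 1) ^ q with hKdef
  have hK : 0 < K := by positivity
  set C : ℝ := 4 * ((1 + Real.exp 1) * 2 ^ q * K * 4 ^ q) + 8 * c * 2 ^ a with hC
  have hC0 : 0 < C := by positivity
  set κ := ((a + 1) * q - 1) / (a + q - 1) with hκ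
  have hκ0 : 0 ≤ κ := div_nonneg (by nlinarith) (by linarith)
  -- With `x = u / 4`, the rate from the block bound is `u ^ 2 / (64 * exp q * B)`; halving it to
  -- absorb the factor `e` gives `128`. The extra `1` in `C + 1` makes the bound trivial for `u <
  -- 1`, where no block length is chosen.
  refine ⟨C + 1, (128 * Real.exp q)⁻¹, by positivity, by positivity, ?_⟩
  intro Ω _ μ _ T X B hX hB0 h0 hM hτ hXB u hu
  have hexp0 : 0 ≤ expNegDiv ((128 * Real.exp q)⁻¹ * u ^ 2) B := by
    unfold expNegDiv
    split_ifs
    exacts [le_rfl, (Real.exp_pos _).le]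
  rcases Nat.eq_zero_or_pos T with rfl | hT
  · simpa [hu.not_gt] using hexp0
  have hT1 : (1 : ℝ) ≤ T := by exact_mod_cast hT
  have hLq : ∀ t ∈ Finset.Icc (1 : ℤ) T, MemLp (X t) (ENNReal.ofReal q) μ := fun t ht =>
    ⟨(hX t).aestronglyMeasurable, (hM t ht).trans_lt ENNReal.ofReal_lt_top⟩
  have hL2 : ∀ t ∈ Finset.Icc (1 : ℤ) T, MemLp (X t) 2 μ := fun t ht =>
    (hLq t ht).mono_exponent (by
      rw [show (2 : ℝ≥0∞) = ENNReal.ofReal 2 by simp]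
      exact ENNReal.ofReal_le_ofReal hq.le)
  have hP1 := measureReal_le_one (μ := μ) (s := {ω | u < |∑ t ∈ Finset.Icc (1 : ℤ) T, X t ω|})
  rcases hB0.eq_or_lt with hB | hB
  · rw [measureReal_lt_abs_sum_eq_zero hu hL2 (fun t _ => h0 t) (by rwa [hB])]
    positivity
  rw [expNegDiv, if_neg hB.ne']
  rcases lt_or_ge u 1 with hu1 | hu1
  · have h1 : 1 ≤ u ^ (-κ) := Real.one_le_rpow_of_pos_of_le_one_of_nonpos hu hu1.le (by linarith)
    have h2 : 1 ≤ (C + 1) * T * u ^ (-κ) :=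
      one_le_mul_of_one_le_of_one_le (one_le_mul_of_one_le_of_one_le (by linarith) hT1) h1
    linarith [Real.exp_pos (-((128 * Real.exp q)⁻¹ * u ^ 2 / B))]
  obtain ⟨J, hJ, hJ1, hJ2⟩ := exists_block_length hq ha hu1
  rw [← hκ] at hJ1 hJ2
  have hmain := measureReal_sum_le_of_block_length hX (x := u / 4) hq hK hB hT hJ
    (by positivity) (by positivity) hLq (fun t _ => h0 t)
    (fun t ht => integral_abs_rpow_le_of_eLpNorm_le (by linarith) (hLq t ht) (by positivity)
      ((hM t ht).trans (ENNReal.ofReal_le_ofReal (le_max_left _ _)))) hXB (hτ J hJ)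
  rw [mul_div_cancel₀ u (by norm_num : (4 : ℝ) ≠ 0)] at hmain
  apply le_add_four_mul_exp hP1 (by positivity)
  have e1 : (u / 4) ^ 2 / (4 * Real.exp q * B) = 2 * ((128 * Real.exp q)⁻¹ * u ^ 2 / B) := by
    field_simp
    ring
  rw [e1] at hmain
  have e2 : (1 + Real.exp 1) * 2 ^ q * ((J : ℝ) ^ (q - 1) * (T * K)) / (u / 4) ^ q ≤
      (1 + Real.exp 1) * 2 ^ q * K * 4 ^ q * (T * u ^ (-κ)) := by
    calc (1 + Real.exp 1) * 2 ^ q * ((J : ℝ) ^ (q - 1) * (T * K)) / (u / 4) ^ q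
        = (1 + Real.exp 1) * 2 ^ q * K * 4 ^ q * (T * ((J : ℝ) ^ (q - 1) / u ^ q)) := by
          rw [Real.div_rpow hu.le (by norm_num)]
          field_simp
      _ ≤ _ := by gcongr
  have e3 : 2 * ((u / 4)⁻¹ * (T * (c * (J : ℝ) ^ (-a)))) ≤ 8 * c * 2 ^ a * (T * u ^ (-κ)) := by
    calc 2 * ((u / 4)⁻¹ * (T * (c * (J : ℝ) ^ (-a))))
        = 8 * c * T * (u⁻¹ * (J : ℝ) ^ (-a)) := by
          rw [inv_div]
          field_simp
          ring
      _ ≤ 8 * c * T * (2 ^ a * u ^ (-κ)) := by gcongr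
      _ = _ := by ring
  have e4 : 0 ≤ T * u ^ (-κ) := by positivity
  have e5 : (C + 1) * T * u ^ (-κ) = 4 * ((1 + Real.exp 1) * 2 ^ q * K * 4 ^ q * (T * u ^ (-κ))) +
      8 * c * 2 ^ a * (T * u ^ (-κ)) + T * u ^ (-κ) := by
    rw [hC]
    ring
  rw [e5]
  linarith

/-! ### Maximum norm: union bound over coordinates -/

theorem theorem3 (q a c M : ℝ) (hq : 2 < q) (ha : 0 < a) (hc : 0 < c) :
    ∃ c₁ c₂ : ℝ, 0 < c₁ ∧ 0 < c₂ ∧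
      ∀ (Ω : Type*) [MeasurableSpace Ω] (μ : Measure Ω) [IsProbabilityMeasure μ]
        (p T : ℕ) (ξ : ℤ → Ω → Fin p → ℝ),
        (∀ t, Measurable (ξ t)) →
        (∀ t j, Integrable (fun ω => ξ t ω j) μ ∧ ∫ ω, ξ t ω j ∂μ = 0) →
        (∀ t ∈ Finset.Icc (1 : ℤ) T, ∀ j,
          eLpNorm (fun ω => ξ t ω j) (ENNReal.ofReal q) μ ≤ ENNReal.ofReal M) →
        (∀ j, ∀ k : ℕ, 1 ≤ k →
          tauMixing μ (fun t ω => ξ t ω j) k ≤ ENNReal.ofReal (c * (k : ℝ) ^ (-a))) →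
        ∀ u : ℝ, 0 < u →
          μ.real {ω | u < ‖∑ t ∈ Finset.Icc (1 : ℤ) T, ξ t ω‖} ≤
            c₁ * p * T * u ^ (-(((a + 1) * q - 1) / (a + q - 1))) +
              4 * p * expNegDiv (c₂ * u ^ 2) (sumCovSq μ ξ T) := by
  obtain ⟨c₁, c₂, hc₁, hc₂, H⟩ := fukNagaev_tauMixing q a c M hq ha hc
  refine ⟨c₁, c₂, hc₁, hc₂, ?_⟩
  intro Ω _ μ _ p T ξ hξ h0 hM hτ u hu
  have hB : ∀ j, ∑ t ∈ Finset.Icc (1 : ℤ) T, ∑ k ∈ Finset.Icc (1 : ℤ) T,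
      |cov[fun ω => ξ t ω j, fun ω => ξ k ω j; μ]| ≤ sumCovSq μ ξ T := fun j =>
    le_ciSup (f := fun j => ∑ t ∈ Finset.Icc (1 : ℤ) T, ∑ k ∈ Finset.Icc (1 : ℤ) T,
      |cov[fun ω => ξ t ω j, fun ω => ξ k ω j; μ]|) (Set.finite_range _).bddAbove j
  -- This includes `p = 0`, where the supremum over the empty type takes the default value `0`.
  have hB0 : 0 ≤ sumCovSq μ ξ T :=
    Real.iSup_nonneg fun j => Finset.sum_nonneg fun _ _ => Finset.sum_nonneg fun _ _ => abs_nonneg _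
  have hsub : {ω | u < ‖∑ t ∈ Finset.Icc (1 : ℤ) T, ξ t ω‖} ⊆
      ⋃ j ∈ Finset.univ, {ω | u < |∑ t ∈ Finset.Icc (1 : ℤ) T, ξ t ω j|} := by
    intro ω hω
    by_contra hne
    simp only [Finset.mem_univ, Set.iUnion_true, Set.mem_iUnion, Set.mem_ofPred_eq, not_exists,
      not_lt] at hne
    have h1 : u < ‖∑ t ∈ Finset.Icc (1 : ℤ) T, ξ t ω‖ := hω
    refine h1.not_ge ((pi_norm_le_iff_of_nonneg hu.le).2 fun j => ?_)
    simpa using hne j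
  refine (measureReal_mono hsub (measure_ne_top _ _)).trans ((measureReal_biUnion_finset_le _ _).trans ?_)
  have hj := fun j => H Ω μ T (fun t ω => ξ t ω j) (sumCovSq μ ξ T)
    (fun t => (measurable_pi_apply j).comp (hξ t)) hB0 (fun t => (h0 t j).2)
    (fun t ht => hM t ht j) (hτ j) (hB j) u hu
  refine (Finset.sum_le_card_nsmul _ _ _ fun j _ => hj j).trans (le_of_eq ?_)
  simp only [Finset.card_univ, Fintype.card_fin, nsmul_eq_mul]
  ring
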